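/- Let $w=w[1]\cdots w[n]$ be a word of length $n$ over an arbitrary alphabet. A factor $r=w[i..j]$, $1\le i\le j\le n$, is regarded as a fragment of $w$, determined by its pair of positions $(i,j)$. A period of a word $u$ is an integer $p\ge 1$ with $u[k]=u[k+p]$ for all $1\le k\le |u|-p$; $p(u)$ denotes the minimal period of $u$, and $e(u)=|u|/p(u)$ its exponent. For $0<\delta<1$, a $\delta$-subrepetition in $w$ is a factor $r$ with $1<e(r)<2$ and $e(r)\ge 1+\delta$. It is maximal if it cannot be extended in $w$ by a letter while preserving its minimal period, that is, for $r=w[i..j]$: if $i>1$ then $w[i-1]\ne w[i-1+p(r)]$, and if $j<n$ then $w[j+1-p(r)]\ne w[j+1]$. The number of maximal $\delta$-subrepetitions in a word of length $n$ is $O(n/\delta)$: there is an absolute constant $C>0$ such that for every alphabet, every $n\ge 0$, every word $w$ of length $n$ and every real $\delta$ with $0<\delta<1$, the number of maximal $\delta$-subrepetitions in $w$ is at most $C\,n/\delta$. -/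

import Mathlib

namespace Subrep

/-- The letter of the word `w` at the position `i`; positions are numbered `1, …, w.length`. -/
def letter {A : Type*} (w : List A) (i : ℕ) : Option A := w[i - 1]?

/-- The factor `w[i..j]` of `w`, as a word (used for `1 ≤ i ≤ j ≤ w.length`). -/
def factor {A : Type*} (w : List A) (i j : ℕ) : List A := (w.drop (i - 1)).take (j + 1 - i)

/-- `p` is a period of `w`: `p > 0` and `w[i] = w[i+p]` for `i = 1, …, w.length - p`. -/
def IsPeriod {A : Type*} (w : List A) (p : ℕ) : Prop := 0 < p ∧ w.HasPeriod p

/-- `IsPeriod` in terms of the letters of the word. -/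
theorem isPeriod_iff {A : Type*} (w : List A) (p : ℕ) :
    IsPeriod w p ↔
      0 < p ∧ ∀ i : ℕ, 1 ≤ i → i + p ≤ w.length → letter w i = letter w (i + p) := by
  unfold IsPeriod letter
  rw [List.hasPeriod_iff_getElem?]
  refine and_congr_right fun _ => ⟨fun h i h1 h2 => ?_, fun h i hi => ?_⟩
  · have := h (i - 1) (by omega)
    rwa [show i - 1 + p = i + p - 1 by omega] at this
  · have := h (i + 1) (by omega) (by omega)
    rwa [show i + 1 - 1 = i by omega, show i + 1 + p - 1 = i + p by omega] at this

/-- The minimal period `p(w)` of a word. -/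
noncomputable def minPeriod {A : Type*} (w : List A) : ℕ := sInf {p : ℕ | IsPeriod w p}

/-- The exponent `e(w) = |w| / p(w)` of a word. -/
noncomputable def exponent {A : Type*} (w : List A) : ℝ := (w.length : ℝ) / (minPeriod w : ℝ)

/-- A subrepetition is a word `r` with `1 < e(r) < 2`. -/
def IsSubrepetition {A : Type*} (r : List A) : Prop := 1 < exponent r ∧ exponent r < 2

/-- A `δ`-subrepetition is a subrepetition `r` with `e(r) ≥ 1 + δ`. -/
def IsDeltaSubrepetition {A : Type*} (δ : ℝ) (r : List A) : Prop :=
  IsSubrepetition r ∧ 1 + δ ≤ exponent r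

/-- Maximality conditions for the fragment `w[i..j]`: it cannot be extended in `w` by one letter,
to the left or to the right, preserving its minimal period. -/
def IsMaximalFragment {A : Type*} (w : List A) (i j : ℕ) : Prop :=
  (1 < i → letter w (i - 1) ≠ letter w (i + minPeriod (factor w i j) - 1)) ∧
  (j < w.length → letter w (j + 1 - minPeriod (factor w i j)) ≠ letter w (j + 1))

open Classical in
/-- The finite set of all maximal `δ`-subrepetitions in `w`. They are counted as fragments of `w`,
each given by its pair `(i, j)` of start and end positions, `1 ≤ i ≤ j ≤ w.length`. -/
noncomputable def maxDeltaSubrepetitions {A : Type*} (δ : ℝ) (w : List A) : Finset (ℕ × ℕ) :=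
  (Finset.Icc 1 w.length ×ˢ Finset.Icc 1 w.length).filter fun f =>
    f.1 ≤ f.2 ∧ IsDeltaSubrepetition δ (factor w f.1 f.2) ∧ IsMaximalFragment w f.1 f.2

end Subrep

/-! A subrepetition of period p and length p + l is a pair of equal arms of length l at distance p.
Maximality makes this a maximal repeat, and exponent at least 1 + δ means p ≤ l/δ ≤ a·l with a =
⌈1/δ⌉. So it suffices to show that there are O(na) such repeats (`card_maxRepeats_le`), by mapping
them injectively into dyadic cells.

Let D be the power of two `scale l`, about l/16, and take the prefix of length 15D of each arm. If
its minimal period is at least D, the repeat is determined by D, i/D and p/D: two repeats in one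
cell with different periods would give the prefix a period smaller than D (`card_aperiodic_le`).

Otherwise the prefix has minimal period q < D, and it is left-maximal in at least one arm
(`leftMaximal_or`), say starting at s. Left-maximal prefixes with q of order Q are determined by any
interior point up to an error Q (`LeftMaximal.unique`, by Fine–Wilf). Marking the point s + p/(4a)
therefore fixes s and also p up to O(aQ); a residue of p/Q modulo 8a removes the remaining ambiguity
(`card_periodic_le`). -/

namespace Subrep

/-! ### Periods on intervals and Fine–Wilf. -/

/-- The values of `f` on the interval `[s, t)` have period `q`. -/
def PeriodicOn {B : Type*} (f : ℕ → B) (s t q : ℕ) : Prop :=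
  ∀ k, s ≤ k → k + q < t → f k = f (k + q)

namespace PeriodicOn

variable {B : Type*} {f : ℕ → B} {s t s' t' p q : ℕ}

theorem mono (h : PeriodicOn f s t q) (hs : s ≤ s') (ht : t' ≤ t) : PeriodicOn f s' t' q :=
  fun k h1 h2 => h k (hs.trans h1) (h2.trans_le ht)

theorem mul (h : PeriodicOn f s t q) (c : ℕ) : PeriodicOn f s t (c * q) := by
  induction c with
  | zero => intro k _ _; simp
  | succ c ih =>
    intro k h1 h2
    rw [Nat.succ_mul] at h2 ⊢
    rw [ih k h1 (by omega), h (k + c * q) (by omega) (by omega), add_assoc]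

theorem of_dvd (h : PeriodicOn f s t q) (hd : q ∣ p) : PeriodicOn f s t p := by
  obtain ⟨c, rfl⟩ := hd
  rw [mul_comm]
  exact h.mul c

/-- A period of a long enough subinterval that divides a period of the interval is a period of
the whole interval. -/
theorem extend {g : ℕ} (hq : 0 < q) (h : PeriodicOn f s t q) (hg : PeriodicOn f s' t' g)
    (hd : g ∣ q) (hs : s ≤ s') (ht : t' ≤ t) (hl : s' + q ≤ t') : PeriodicOn f s t g := by
  -- Shifts by multiples of `q` bring every position into the window `[s', s' + q)` without changing
  -- its residue mod `q`, hence mod `g`; there the `g`-periodicity applies.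
  have key : ∀ k, s ≤ k → k < t →
      ∃ k', s' ≤ k' ∧ k' < s' + q ∧ f k = f k' ∧ (k' ≡ k [MOD q]) := by
    intro k h1 h2
    rcases lt_or_ge k s' with hk | hk
    · refine ⟨k + ((s' - k + q - 1) / q) * q, ?_, ?_, ?_, ?_⟩
      · have := Nat.div_add_mod (s' - k + q - 1) q
        have := Nat.mod_lt (s' - k + q - 1) hq
        rw [mul_comm q] at *
        omega
      · have := Nat.div_mul_le_self (s' - k + q - 1) q
        omega
      · have := Nat.div_mul_le_self (s' - k + q - 1) q
        exact h.mul _ k h1 (by omega)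
      · simp [Nat.ModEq]
    · have e := Nat.div_add_mod (k - s') q
      rw [mul_comm q] at e
      have l := Nat.mod_lt (k - s') hq
      have e' : s' + (k - s') % q + (k - s') / q * q = k := by omega
      refine ⟨s' + (k - s') % q, by omega, by omega, ?_, ?_⟩
      · have := h.mul ((k - s') / q) (s' + (k - s') % q) (by omega) (by omega)
        rw [this, e']
      · conv_rhs => rw [← e']
        simp [Nat.ModEq]
  have inner : ∀ x y, s' ≤ x → x ≤ y → y < t' → x ≡ y [MOD g] → f x = f y := by
    intro x y h1 h2 h3 h4
    obtain ⟨c, hc⟩ := (Nat.modEq_iff_dvd' h2).1 h4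
    have := hg.mul c x h1 (by rw [mul_comm]; omega)
    rw [this]
    congr 1
    rw [mul_comm]
    omega
  intro k h1 h2
  obtain ⟨x, x1, x2, x3, x4⟩ := key k h1 (by omega)
  obtain ⟨y, y1, y2, y3, y4⟩ := key (k + g) (by omega) h2
  have hxy : x ≡ y [MOD g] :=
    ((x4.of_dvd hd).trans (by simp [Nat.ModEq])).trans (y4.of_dvd hd).symm
  rw [x3, y3]
  rcases le_total x y with h | h
  · exact inner x y x1 h (by omega) hxy
  · exact (inner y x y1 h (by omega) hxy.symm).symm

/-- A weak form of the Fine–Wilf theorem. -/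
theorem gcd (hp0 : 0 < p) (hq0 : 0 < q) (hp : PeriodicOn f s t p) (hq : PeriodicOn f s t q)
    (hl : s + p + q ≤ t) : PeriodicOn f s t (Nat.gcd p q) := by
  induction hn : p + q using Nat.strong_induction_on generalizing p q t with
  | _ n ih =>
    wlog hlt : q ≤ p generalizing p q
    · rw [Nat.gcd_comm]
      exact this hq0 hp0 hq hp (by omega) (by omega) (by omega)
    rcases hlt.eq_or_lt with rfl | hlt
    · simpa using hq
    have hsub : PeriodicOn f s (t - q) (p - q) := by
      intro k h1 h2
      rw [hp k h1 (by omega), hq (k + (p - q)) (by omega) (by omega)]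
      congr 1
      omega
    -- A Euclidean step on `[s, t - q)`. That interval still has length at least `p > q`, so the gcd
    -- period extends back to `[s, t)`.
    have hg := ih p (by omega) (p := p - q) (by omega) hq0 hsub (hq.mono le_rfl (by omega))
      (by omega) (by omega)
    rw [Nat.gcd_sub_self_left hlt.le] at hg
    exact extend hq0 hq hg (Nat.gcd_dvd_right _ _) le_rfl (by omega) (by omega)

end PeriodicOn

/-! ### Minimal periods and left-maximal intervals. -/

/-- The minimal period of `f` on the interval `[s, s + m)`. -/
noncomputable def minPeriodOn {B : Type*} (f : ℕ → B) (s m : ℕ) : ℕ :=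
  sInf {q | 0 < q ∧ PeriodicOn f s (s + m) q}

theorem minPeriodOn_spec {B : Type*} (f : ℕ → B) (s m : ℕ) :
    0 < minPeriodOn f s m ∧ PeriodicOn f s (s + m) (minPeriodOn f s m) :=
  Nat.sInf_mem (s := {q | 0 < q ∧ PeriodicOn f s (s + m) q})
    ⟨m + 1, Nat.succ_pos _, fun k _ h2 => absurd h2 (by omega)⟩

theorem minPeriodOn_le {B : Type*} {f : ℕ → B} {s m q : ℕ} (hq : 0 < q)
    (h : PeriodicOn f s (s + m) q) : minPeriodOn f s m ≤ q :=
  Nat.sInf_le ⟨hq, h⟩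

theorem minPeriodOn_shift {B : Type*} {f : ℕ → B} {s m p : ℕ}
    (h : ∀ k, s ≤ k → k < s + m → f k = f (k + p)) :
    minPeriodOn f (s + p) m = minPeriodOn f s m := by
  unfold minPeriodOn
  congr 1
  ext q
  refine and_congr_right fun _ => ⟨fun H k h1 h2 => ?_, fun H k h1 h2 => ?_⟩
  · rw [h k h1 (by omega), h (k + q) (by omega) h2, H (k + p) (by omega) (by omega)]
    congr 1
    omega
  · have e := H (k - p) (by omega) (by omega)
    rw [h (k - p) (by omega) (by omega), h (k - p + q) (by omega) (by omega)] at e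
    rwa [show k - p + p = k by omega, show k - p + q + p = k + q by omega] at e

/-- The interval `[s, s + m)` cannot be extended by one position to the left preserving its
minimal period. -/
def LeftMaximal {B : Type*} (f : ℕ → B) (s m : ℕ) : Prop :=
  1 < s → f (s - 1) ≠ f (s - 1 + minPeriodOn f s m)

/-- Two left-maximal highly periodic intervals with periods of the same order of magnitude that
have close interior points coincide in their starts and minimal periods. -/
theorem LeftMaximal.unique {B : Type*} {f : ℕ → B} {s m s' m' x x' Q : ℕ}
    (hs : 1 ≤ s) (hs' : 1 ≤ s') (h : LeftMaximal f s m) (h' : LeftMaximal f s' m')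
    (h1 : Q ≤ minPeriodOn f s m) (h2 : minPeriodOn f s m < 2 * Q)
    (h1' : Q ≤ minPeriodOn f s' m') (h2' : minPeriodOn f s' m' < 2 * Q)
    (hx : s ≤ x) (hx' : s' ≤ x') (hm : x + 6 * Q ≤ s + m) (hm' : x' + 6 * Q ≤ s' + m')
    (hxx : x < x' + Q) (hxx' : x' < x + Q) :
    s = s' ∧ minPeriodOn f s m = minPeriodOn f s' m' := by
  obtain ⟨q0, hq⟩ := minPeriodOn_spec f s m
  obtain ⟨q0', hq'⟩ := minPeriodOn_spec f s' m'
  have hmin := @minPeriodOn_le B f s m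
  have hmin' := @minPeriodOn_le B f s' m'
  unfold LeftMaximal at h h'
  generalize minPeriodOn f s m = q at *
  generalize minPeriodOn f s' m' = q' at *
  -- The overlap runs at least from `max x x'` to `min x x' + 6 * Q`, so it is longer than `5 * Q`,
  -- whereas `q + q' < 4 * Q`.
  have hg := PeriodicOn.gcd (s := max s s') (t := min (s + m) (s' + m')) q0 q0'
    (hq.mono (le_max_left _ _) (min_le_left _ _))
    (hq'.mono (le_max_right _ _) (min_le_right _ _)) (by omega)
  have g0 : 0 < Nat.gcd q q' := Nat.gcd_pos_of_pos_left _ q0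
  have e : q ≤ Nat.gcd q q' := hmin g0 (hq.extend q0 hg (Nat.gcd_dvd_left _ _)
    (le_max_left _ _) (min_le_left _ _) (by omega))
  have e' : q' ≤ Nat.gcd q q' := hmin' g0 (hq'.extend q0' hg (Nat.gcd_dvd_right _ _)
    (le_max_right _ _) (min_le_right _ _) (by omega))
  have l := Nat.gcd_le_left q' q0
  have l' := Nat.gcd_le_right q q0'
  obtain rfl : q = q' := by omega
  refine ⟨?_, rfl⟩
  -- The interval that starts earlier would extend the other one to the left with the common period.
  rcases lt_trichotomy s s' with hlt | heq | hlt
  · exact absurd (hq (s' - 1) (by omega) (by omega)) (h' (by omega))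
  · exact heq
  · exact absurd (hq' (s - 1) (by omega) (by omega)) (h (by omega))

/-! ### Maximal repeats. -/

/-- A maximal repeat in `f` on the positions `1, …, n`: the arms `[i, i + l)` and
`[i + p, i + p + l)` carry the same values, the arms cannot be extended, and `p ≤ a * l`. -/
structure IsMaxRepeat {B : Type*} (f : ℕ → B) (n a i p l : ℕ) : Prop where
  pos : 1 ≤ i
  arm_pos : 0 < l
  period_pos : 0 < p
  le_length : i + p + l ≤ n + 1
  period_le : p ≤ a * l
  eq_shift : ∀ k, i ≤ k → k < i + l → f k = f (k + p)
  left_max : 1 < i → f (i - 1) ≠ f (i - 1 + p)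
  right_max : i + p + l ≤ n → f (i + l) ≠ f (i + l + p)

namespace IsMaxRepeat

variable {B : Type*} {f : ℕ → B} {n a i p l i' p' l' : ℕ}

/-- Maximal repeats with the same period and intersecting left arms coincide. -/
theorem eq_of_period_eq (h : IsMaxRepeat f n a i p l) (h' : IsMaxRepeat f n a i' p l')
    (h1 : i ≤ i' + l') (h2 : i' ≤ i + l) : i = i' ∧ l = l' := by
  have := h.pos
  have := h'.pos
  have hi : i = i' := by
    rcases lt_trichotomy i i' with hlt | heq | hlt
    · exact absurd (h.eq_shift (i' - 1) (by omega) (by omega)) (h'.left_max (by omega))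
    · exact heq
    · exact absurd (h'.eq_shift (i - 1) (by omega) (by omega)) (h.left_max (by omega))
  subst hi
  refine ⟨rfl, ?_⟩
  have := h.le_length
  have := h'.le_length
  rcases lt_trichotomy l l' with hlt | heq | hlt
  · exact absurd (h'.eq_shift (i + l) (by omega) (by omega)) (h.right_max (by omega))
  · exact heq
  · exact absurd (h.eq_shift (i + l') (by omega) (by omega)) (h'.right_max (by omega))

/-- On the intersection of the left arms, the difference of the periods of two repeats is
a period. -/
theorem periodicOn_sub (h : IsMaxRepeat f n a i p l) (h' : IsMaxRepeat f n a i' p' l')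
    (hp : p ≤ p') : PeriodicOn f (max i i') (min (i + l) (i' + l')) (p' - p) := by
  intro k h1 h2
  rw [h'.eq_shift k (by omega) (by omega), h.eq_shift (k + (p' - p)) (by omega) (by omega)]
  congr 1
  omega

/-- The same for right arms with a common start. -/
theorem periodicOn_sub_right (h : IsMaxRepeat f n a i p l) (h' : IsMaxRepeat f n a i' p' l')
    (hp : p ≤ p') (hs : i + p = i' + p') :
    PeriodicOn f (i + p) (i + p + min l l') (p' - p) := by
  intro k h1 h2
  have e := h.eq_shift (k - p) (by omega) (by omega)
  have e' := h'.eq_shift (k + (p' - p) - p') (by omega) (by omega)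
  rw [show k - p + p = k by omega] at e
  rw [show k + (p' - p) - p' + p' = k + (p' - p) by omega,
    show k + (p' - p) - p' = k - p by omega] at e'
  exact e.symm.trans e'

end IsMaxRepeat

/-! ### Scales and dyadic cells. -/

/-- The scale of a repeat with arms of length `l`. -/
def scale (l : ℕ) : ℕ := 2 ^ Nat.log 2 (l / 16)

theorem scale_pos (l : ℕ) : 0 < scale l := by unfold scale; positivity

theorem lt_scale (l : ℕ) : l < 32 * scale l := by
  have := Nat.lt_pow_succ_log_self (b := 2) (by norm_num) (l / 16)
  rw [pow_succ] at this
  unfold scale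
  omega

/-- The hypothesis excludes `l < 16`, where `Nat.log 2 0 = 0` gives scale 1 and the bound fails. -/
theorem scale_le {l : ℕ} (h : 1 < scale l) : 16 * scale l ≤ l := by
  have h0 : l / 16 ≠ 0 := by
    intro h0
    simp [scale, h0] at h
  have := Nat.pow_log_le_self 2 h0
  unfold scale
  omega

/-- Cells of the dyadic grids of mesh `2 ^ d`, with a label less than `M`. -/
def cells (n M : ℕ) : Finset (Σ _ : ℕ, ℕ × ℕ) :=
  (Finset.range (Nat.log 2 n + 1)).sigma fun d => Finset.range (n / 2 ^ d + 1) ×ˢ Finset.range M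

/-- The geometric sum of `n / 2 ^ d` is at most `2 * n`, and the extra 1 per level adds `Nat.log 2 n
+ 1 ≤ n`. -/
theorem card_cells {n : ℕ} (M : ℕ) (hn : n ≠ 0) : (cells n M).card ≤ 3 * n * M := by
  unfold cells
  simp only [Finset.card_sigma, Finset.card_product, Finset.card_range]
  rw [← Finset.sum_mul]
  refine Nat.mul_le_mul_right M ?_
  rw [Finset.sum_add_distrib]
  have h1 := Nat.geom_sum_le (b := 2) le_rfl n (Nat.log 2 n + 1)
  have h2 := Nat.log_lt_self 2 hn
  simp only [Finset.sum_const, Finset.card_range, smul_eq_mul, mul_one]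
  omega

theorem mem_cells {n M d x y : ℕ} (hd : 2 ^ d ≤ n) (hx : x ≤ n) (hy : y < M) :
    (⟨d, x / 2 ^ d, y⟩ : Σ _ : ℕ, ℕ × ℕ) ∈ cells n M := by
  unfold cells
  simp only [Finset.mem_sigma, Finset.mem_product, Finset.mem_range]
  exact ⟨Nat.lt_succ_of_le (Nat.le_log_of_pow_le (by norm_num) hd),
    Nat.lt_succ_of_le (Nat.div_le_div_right hx), hy⟩

theorem lt_add_of_div_eq {x y Q : ℕ} (hQ : 0 < Q) (h : x / Q = y / Q) : x < y + Q := by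
  have h1 := Nat.div_add_mod x Q
  have h2 := Nat.div_add_mod y Q
  have h3 := Nat.mod_lt x hQ
  rw [h] at h1
  omega

/-! ### Counting maximal repeats. -/

/-- The repeats without a highly periodic prefix of the arms. -/
theorem card_aperiodic_le {B : Type*} {f : ℕ → B} {n a : ℕ} (hn : n ≠ 0)
    (S : Finset (ℕ × ℕ × ℕ)) (hS : ∀ t ∈ S, IsMaxRepeat f n a t.1 t.2.1 t.2.2)
    (hN : ∀ t ∈ S, scale t.2.2 ≤ minPeriodOn f t.1 (15 * scale t.2.2)) :
    S.card ≤ 3 * n * (32 * a) := by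
  refine le_trans (Finset.card_le_card_of_injOn
    (fun t => ⟨Nat.log 2 (t.2.2 / 16), t.1 / scale t.2.2, t.2.1 / scale t.2.2⟩) ?_ ?_)
    (card_cells (32 * a) hn)
  · rintro ⟨i, p, l⟩ ht
    have h := hS _ ht
    have h1 := h.pos
    have h2 := h.le_length
    have h3 := h.arm_pos
    have h4 := h.period_le
    have h5 := scale_pos l
    have h6 := lt_scale l
    dsimp only at *
    refine mem_cells ?_ (by omega) ?_
    · change scale l ≤ n
      rcases le_or_gt (scale l) 1 with h | h
      · omega
      · have := scale_le h
        omega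
    · rw [Nat.div_lt_iff_lt_mul h5]
      have ha : 0 < a := Nat.pos_of_ne_zero fun h0 => by
        have := h.period_pos
        simp_all
      calc p ≤ a * l := h4
        _ < a * (32 * scale l) := by gcongr
        _ = 32 * a * scale l := by ring
  · have key : ∀ i p l i' p' l', (i, p, l) ∈ S → (i', p', l') ∈ S → scale l = scale l' →
        i / scale l = i' / scale l → p / scale l = p' / scale l → p ≤ p' →
        (i, p, l) = (i', p', l') := by
      intro i p l i' p' l' ht ht' hd hi hpp hle
      have h := hS _ ht
      have h' := hS _ ht'
      have m := hN _ ht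
      have m' := hN _ ht'
      have D0 := scale_pos l
      have hl := h.arm_pos
      have hl' := h'.arm_pos
      have b := @scale_le l
      have b' := @scale_le l'
      dsimp only at *
      rw [← hd] at m' b'
      have i1 := lt_add_of_div_eq D0 hi
      have i2 := lt_add_of_div_eq D0 hi.symm
      have p2 := lt_add_of_div_eq D0 hpp.symm
      have hpp : p = p' := by
        by_contra hne
        have hb := b (by omega)
        have hb' := b' (by omega)
        have hper := h.periodicOn_sub h' hle
        -- The starts differ by less than D and the arms have length at least 16D, so the 15D-prefix
        -- of the later left arm lies in both arms. There `p' - p < D` is a period, against `hN`.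
        rcases le_total i i' with hii | hii
        · have := minPeriodOn_le (s := i') (m := 15 * scale l) (by omega)
            (hper.mono (by omega) (by omega))
          omega
        · have := minPeriodOn_le (s := i) (m := 15 * scale l) (by omega)
            (hper.mono (by omega) (by omega))
          omega
      subst hpp
      have hscale : i ≤ i' + l' ∧ i' ≤ i + l := by
        rcases le_or_gt (scale l) 1 with h | h
        · omega
        · have := b h
          have := b' h
          omega
      obtain ⟨rfl, rfl⟩ := h.eq_of_period_eq h' hscale.1 hscale.2
      rfl
    rintro ⟨i, p, l⟩ ht ⟨i', p', l'⟩ ht' e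
    simp only [Sigma.mk.injEq, heq_eq_eq, Prod.mk.injEq] at e
    obtain ⟨e1, e2, e3⟩ := e
    have hd : scale l = scale l' := by
      unfold scale
      rw [e1]
    rw [← hd] at e2 e3
    rcases le_total p p' with hle | hle
    · exact key _ _ _ _ _ _ ht ht' hd e2 e3 hle
    · exact (key _ _ _ _ _ _ ht' ht hd.symm (by rw [← hd]; exact e2.symm)
        (by rw [← hd]; exact e3.symm) hle).symm

/-- The repeats with a highly periodic prefix `[s, s + m)` of the left (`s = i`) or right
(`s = i + p`) arm which is left-maximal. -/
theorem card_periodic_le {B : Type*} {f : ℕ → B} {n a : ℕ} (hn : n ≠ 0)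
    (S : Finset (ℕ × ℕ × ℕ)) (hS : ∀ t ∈ S, IsMaxRepeat f n a t.1 t.2.1 t.2.2)
    (σ : ℕ → ℕ → ℕ) (hσ : (∀ i p, σ i p = i) ∨ ∀ i p, σ i p = i + p)
    (hN : ∀ t ∈ S, minPeriodOn f (σ t.1 t.2.1) (15 * scale t.2.2) < scale t.2.2)
    (hL : ∀ t ∈ S, LeftMaximal f (σ t.1 t.2.1) (15 * scale t.2.2)) :
    S.card ≤ 3 * n * (32 * a) := by
  set q : ℕ × ℕ × ℕ → ℕ := fun t => minPeriodOn f (σ t.1 t.2.1) (15 * scale t.2.2) with hq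
  -- The marked point encodes both the start of the prefix and, coarsely, the period `p`. As `p ≤
  -- 32aD`, the offset is at most 8D, which leaves 7D of the prefix to the right.
  set x : ℕ × ℕ × ℕ → ℕ := fun t => σ t.1 t.2.1 + t.2.1 / (4 * a) with hx
  have basic : ∀ t ∈ S, 0 < q t ∧ 0 < a ∧ q t < scale t.2.2 ∧ 16 * scale t.2.2 ≤ t.2.2 ∧
      2 ^ Nat.log 2 (q t) ≤ q t ∧ q t < 2 * 2 ^ Nat.log 2 (q t) ∧
      x t ≤ σ t.1 t.2.1 + 8 * scale t.2.2 := by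
    intro t ht
    have h := hS t ht
    have q0 : 0 < q t := (minPeriodOn_spec _ _ _).1
    have qs : q t < scale t.2.2 := hN t ht
    have ha : 0 < a := Nat.pos_of_ne_zero fun h0 => by
      have h1 := h.period_pos
      have h2 := h.period_le
      simp only [h0, zero_mul] at h2
      omega
    refine ⟨q0, ha, qs, scale_le (by omega), Nat.pow_log_le_self 2 q0.ne', ?_, ?_⟩
    · have := Nat.lt_pow_succ_log_self (b := 2) (by norm_num) (q t)
      rw [pow_succ] at this
      omega
    · have hdiv : t.2.1 / (4 * a) ≤ 8 * scale t.2.2 := by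
        apply Nat.div_le_of_le_mul
        calc t.2.1 ≤ a * t.2.2 := h.period_le
          _ ≤ a * (32 * scale t.2.2) := by
            have := (lt_scale t.2.2).le
            gcongr
          _ = 4 * a * (8 * scale t.2.2) := by ring
      simp only [hx]
      omega
  refine le_trans (Finset.card_le_card_of_injOn
    (fun t => ⟨Nat.log 2 (q t), x t / 2 ^ Nat.log 2 (q t),
      (t.2.1 / 2 ^ Nat.log 2 (q t)) % (8 * a)⟩) ?_ ?_)
    (card_cells (32 * a) hn)
  · intro t ht
    have h := hS t ht
    have h1 := h.pos
    have h2 := h.le_length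
    obtain ⟨b1, b2, b3, b4, b5, b6, b7⟩ := basic t ht
    have hs : σ t.1 t.2.1 ≤ t.1 + t.2.1 := by
      rcases hσ with hσ | hσ <;> rw [hσ] <;> omega
    refine mem_cells (by omega) (by omega) ?_
    exact (Nat.mod_lt _ (by omega)).trans_le (by omega)
  · have key : ∀ t ∈ S, ∀ t' ∈ S, Nat.log 2 (q t) = Nat.log 2 (q t') →
        x t / 2 ^ Nat.log 2 (q t) = x t' / 2 ^ Nat.log 2 (q t) →
        (t.2.1 / 2 ^ Nat.log 2 (q t)) % (8 * a) = (t'.2.1 / 2 ^ Nat.log 2 (q t)) % (8 * a) →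
        t.2.1 ≤ t'.2.1 → t = t' := by
      intro t ht t' ht' e1 e2 e3 hle
      have h := hS t ht
      have h' := hS t' ht'
      obtain ⟨b1, b2, b3, b4, b5, b6, b7⟩ := basic t ht
      obtain ⟨b1', -, b3', b4', b5', b6', b7'⟩ := basic t' ht'
      have L := hL t ht
      have L' := hL t' ht'
      rw [← e1] at b5' b6'
      have Q0 : 0 < 2 ^ Nat.log 2 (q t) := by positivity
      generalize 2 ^ Nat.log 2 (q t) = Q at *
      have x1 := lt_add_of_div_eq Q0 e2
      have x2 := lt_add_of_div_eq Q0 e2.symm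
      have hpos : ∀ t ∈ S, 1 ≤ σ t.1 t.2.1 := by
        intro t ht
        have := (hS t ht).pos
        rcases hσ with hσ | hσ <;> rw [hσ] <;> omega
      obtain ⟨hs, hqq⟩ := L.unique (hpos t ht) (hpos t' ht') L' b5 b6 b5' b6'
        (x := x t) (x' := x t') (Nat.le_add_right _ _) (Nat.le_add_right _ _) (by omega)
        (by omega) x1 x2
      change q t = q t' at hqq
      -- With equal starts, closeness of the marked points becomes closeness of the periods. The
      -- quotients by `Q` then differ by at most `4 * a`, so their residues mod `8 * a` decide
      -- equality.
      have hdiv : t'.2.1 / (4 * a) < t.2.1 / (4 * a) + Q := by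
        simp only [hx] at x2
        omega
      have hlt : t'.2.1 < t.2.1 + 4 * a * Q := by
        rw [Nat.div_lt_iff_lt_mul (by omega)] at hdiv
        have := Nat.div_mul_le_self t.2.1 (4 * a)
        calc t'.2.1 < (t.2.1 / (4 * a) + Q) * (4 * a) := hdiv
          _ = t.2.1 / (4 * a) * (4 * a) + 4 * a * Q := by ring
          _ ≤ t.2.1 + 4 * a * Q := by omega
      have hlt2 : t'.2.1 / Q ≤ t.2.1 / Q + 4 * a := by
        calc t'.2.1 / Q ≤ (t.2.1 + 4 * a * Q) / Q := Nat.div_le_div_right hlt.le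
          _ = t.2.1 / Q + 4 * a := Nat.add_mul_div_right _ _ Q0
      have hle2 : t.2.1 / Q ≤ t'.2.1 / Q := Nat.div_le_div_right hle
      have hcell : t.2.1 / Q = t'.2.1 / Q := by
        have hd := (Nat.modEq_iff_dvd' hle2).1 e3
        have := Nat.eq_zero_of_dvd_of_lt hd (by omega)
        omega
      have hp2 := lt_add_of_div_eq Q0 hcell.symm
      -- Otherwise the difference of the periods, less than `Q ≤ q`, would be a period of the
      -- prefix.
      have hp : t.2.1 = t'.2.1 := by
        by_contra hne
        have hper : PeriodicOn f (σ t.1 t.2.1) (σ t.1 t.2.1 + min t.2.2 t'.2.2)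
            (t'.2.1 - t.2.1) := by
          rcases hσ with hσ | hσ
          · rw [hσ, hσ] at hs
            rw [hσ]
            exact (h.periodicOn_sub h' hle).mono (by omega) (by omega)
          · rw [hσ, hσ] at hs
            rw [hσ]
            exact h.periodicOn_sub_right h' hle hs
        rcases le_total t.2.2 t'.2.2 with hl | hl
        · have : q t ≤ t'.2.1 - t.2.1 :=
            minPeriodOn_le (by omega) (hper.mono le_rfl (by omega))
          omega
        · have : q t' ≤ t'.2.1 - t.2.1 :=
            minPeriodOn_le (by omega) (hper.mono hs.le (by omega))
          omega
      have hi : t.1 = t'.1 := by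
        rcases hσ with hσ | hσ <;> rw [hσ, hσ] at hs <;> omega
      obtain ⟨i, p, l⟩ := t
      obtain ⟨i', p', l'⟩ := t'
      dsimp only at *
      subst hp hi
      obtain ⟨-, rfl⟩ := h.eq_of_period_eq h' (by omega) (by omega)
      rfl
    intro t ht t' ht' e
    simp only [Sigma.mk.injEq, heq_eq_eq, Prod.mk.injEq] at e
    obtain ⟨e1, e2, e3⟩ := e
    rw [← e1] at e2 e3
    rcases le_total t.2.1 t'.2.1 with hle | hle
    · exact key _ ht _ ht' e1 e2 e3 hle
    · exact (key _ ht' _ ht e1.symm (by rw [← e1]; exact e2.symm)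
        (by rw [← e1]; exact e3.symm) hle).symm

/-- If an arm of a maximal repeat has a periodic prefix, then the prefix is left-maximal in
the left or in the right arm. -/
theorem IsMaxRepeat.leftMaximal_or {B : Type*} {f : ℕ → B} {n a i p l m : ℕ}
    (h : IsMaxRepeat f n a i p l) (hm : m ≤ l) (hq : minPeriodOn f i m < m) :
    LeftMaximal f i m ∨ LeftMaximal f (i + p) m := by
  have e : minPeriodOn f (i + p) m = minPeriodOn f i m :=
    minPeriodOn_shift fun k h1 h2 => h.eq_shift k h1 (by omega)
  have q0 := (minPeriodOn_spec f i m).1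
  by_contra! hc
  unfold LeftMaximal at hc
  rw [e] at hc
  push Not at hc
  obtain ⟨⟨h1, h2⟩, -, h3⟩ := hc
  -- If both prefixes extended to the left with period q, then f(i-1) = f(i-1+q) = f(i-1+q+p) =
  -- f(i-1+p), so the arms themselves would extend.
  refine h.left_max h1 ?_
  rw [h2, h.eq_shift _ (by omega) (by omega), show i - 1 + p = i + p - 1 by omega, h3]
  congr 1
  omega

/-- Three classes (aperiodic, left-maximal in the left arm, left-maximal in the right arm) have at
most `3 * n * (32 * a)` members each. Arms shorter than 16 have scale 1 and fall into the aperiodic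
class. -/
theorem card_maxRepeats_le {B : Type*} {f : ℕ → B} {n a : ℕ} (hn : n ≠ 0)
    (S : Finset (ℕ × ℕ × ℕ)) (hS : ∀ t ∈ S, IsMaxRepeat f n a t.1 t.2.1 t.2.2) :
    S.card ≤ 288 * n * a := by
  classical
  set N := S.filter fun t => scale t.2.2 ≤ minPeriodOn f t.1 (15 * scale t.2.2)
  set L := S.filter fun t => minPeriodOn f t.1 (15 * scale t.2.2) < scale t.2.2 ∧
    LeftMaximal f t.1 (15 * scale t.2.2)
  set R := S.filter fun t => minPeriodOn f (t.1 + t.2.1) (15 * scale t.2.2) < scale t.2.2 ∧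
    LeftMaximal f (t.1 + t.2.1) (15 * scale t.2.2)
  have hsub : S ⊆ N ∪ L ∪ R := by
    intro t ht
    simp only [N, L, R, Finset.mem_union, Finset.mem_filter, ht, true_and]
    rcases le_or_gt (scale t.2.2) (minPeriodOn f t.1 (15 * scale t.2.2)) with h | h
    · exact Or.inl (Or.inl h)
    · have q0 := (minPeriodOn_spec f t.1 (15 * scale t.2.2)).1
      have hs := @scale_le t.2.2 (by omega)
      have e : minPeriodOn f (t.1 + t.2.1) (15 * scale t.2.2) =
          minPeriodOn f t.1 (15 * scale t.2.2) :=
        minPeriodOn_shift fun k h1 h2 => (hS t ht).eq_shift k h1 (by omega)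
      rw [e]
      rcases (hS t ht).leftMaximal_or (m := 15 * scale t.2.2) (by omega) (by omega) with h' | h'
      · exact Or.inl (Or.inr ⟨h, h'⟩)
      · exact Or.inr ⟨h, h'⟩
  have hN : N.card ≤ 3 * n * (32 * a) := card_aperiodic_le hn N
    (fun t ht => hS t (Finset.mem_filter.1 ht).1) fun t ht => (Finset.mem_filter.1 ht).2
  have hL : L.card ≤ 3 * n * (32 * a) := card_periodic_le hn L
    (fun t ht => hS t (Finset.mem_filter.1 ht).1) (fun i _ => i) (Or.inl fun _ _ => rfl)
    (fun t ht => (Finset.mem_filter.1 ht).2.1) fun t ht => (Finset.mem_filter.1 ht).2.2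
  have hR : R.card ≤ 3 * n * (32 * a) := card_periodic_le hn R
    (fun t ht => hS t (Finset.mem_filter.1 ht).1) (fun i p => i + p) (Or.inr fun _ _ => rfl)
    (fun t ht => (Finset.mem_filter.1 ht).2.1) fun t ht => (Finset.mem_filter.1 ht).2.2
  calc S.card ≤ (N ∪ L ∪ R).card := Finset.card_le_card hsub
    _ ≤ N.card + L.card + R.card :=
      (Finset.card_union_le _ _).trans (Nat.add_le_add_right (Finset.card_union_le _ _) _)
    _ ≤ 3 * n * (32 * a) + 3 * n * (32 * a) + 3 * n * (32 * a) := by gcongr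
    _ = 288 * n * a := by ring

/-! ### From subrepetitions to maximal repeats. -/

theorem letter_factor {A : Type*} (w : List A) {i j k : ℕ} (hi : 1 ≤ i) (hk : 1 ≤ k)
    (h : i + k ≤ j + 1) : letter (factor w i j) k = letter w (i + k - 1) := by
  unfold letter factor
  rw [List.getElem?_take_of_lt (by omega), List.getElem?_drop]
  congr 1
  omega

theorem length_factor {A : Type*} (w : List A) {i j : ℕ} (hi : 1 ≤ i) (hj : j ≤ w.length) :
    (factor w i j).length = j + 1 - i := by
  unfold factor
  rw [List.length_take, List.length_drop]
  omega

/-- A maximal `δ`-subrepetition gives a maximal repeat. -/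
theorem isMaxRepeat_of_mem {A : Type*} {w : List A} {δ : ℝ} (hδ : 0 < δ) {i j : ℕ}
    (h : (i, j) ∈ maxDeltaSubrepetitions δ w) :
    minPeriod (factor w i j) ≤ j + 1 - i ∧
    IsMaxRepeat (letter w) w.length ⌈1 / δ⌉₊ i (minPeriod (factor w i j))
      (j + 1 - i - minPeriod (factor w i j)) := by
  simp only [maxDeltaSubrepetitions, Finset.mem_filter, Finset.mem_product, Finset.mem_Icc] at h
  obtain ⟨⟨⟨hi, -⟩, -, hj⟩, hij, ⟨⟨h1, -⟩, h3⟩, h4, h5⟩ := h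
  have hlen := length_factor w hi hj
  have hper : IsPeriod (factor w i j) (minPeriod (factor w i j)) := by
    refine Nat.sInf_mem (s := {p | IsPeriod (factor w i j) p}) ⟨j + 1 - i, ?_⟩
    refine (isPeriod_iff _ _).2 ⟨by omega, fun k h1 h2 => absurd h2 (by omega)⟩
  rw [isPeriod_iff, hlen] at hper
  unfold exponent at h1 h3
  rw [hlen] at h1 h3
  generalize minPeriod (factor w i j) = p at *
  obtain ⟨hp, hper⟩ := hper
  have hp' : (0 : ℝ) < p := by exact_mod_cast hp
  rw [lt_div_iff₀ hp', one_mul] at h1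
  rw [le_div_iff₀ hp'] at h3
  have hlt : p < j + 1 - i := by exact_mod_cast h1
  refine ⟨hlt.le, ⟨hi, by omega, hp, by omega, ?_, ?_, ?_, ?_⟩⟩
  · have hl : ((j + 1 - i - p : ℕ) : ℝ) = ((j + 1 - i : ℕ) : ℝ) - p := Nat.cast_sub hlt.le
    have hle : (p : ℝ) ≤ (⌈1 / δ⌉₊ : ℝ) * ((j + 1 - i - p : ℕ) : ℝ) := by
      calc (p : ℝ) = 1 / δ * (δ * p) := by field_simp
        _ ≤ 1 / δ * ((j + 1 - i - p : ℕ) : ℝ) := by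
          gcongr
          rw [hl]
          linarith
        _ ≤ _ := by
          gcongr
          exact Nat.le_ceil _
    exact_mod_cast hle
  · intro k k1 k2
    have e := hper (k + 1 - i) (by omega) (by omega)
    rw [letter_factor w hi (by omega) (by omega), letter_factor w hi (by omega) (by omega)] at e
    rwa [show i + (k + 1 - i) - 1 = k by omega,
      show i + (k + 1 - i + p) - 1 = k + p by omega] at e
  · intro hi1
    have := h4 hi1
    rwa [show i + p - 1 = i - 1 + p by omega] at this
  · intro hj1
    have := h5 (by omega)
    have e1 : i + (j + 1 - i - p) = j + 1 - p := by omega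
    have e2 : j + 1 - p + p = j + 1 := by omega
    rwa [e1, e2]

theorem card_maxDeltaSubrepetitions_le {A : Type*} (w : List A) {δ : ℝ} (hδ : 0 < δ) :
    (maxDeltaSubrepetitions δ w).card ≤ 288 * w.length * ⌈1 / δ⌉₊ := by
  rcases Nat.eq_zero_or_pos w.length with hn | hn
  · simp [maxDeltaSubrepetitions, hn]
  set g : ℕ × ℕ → ℕ × ℕ × ℕ := fun t => (t.1, minPeriod (factor w t.1 t.2),
    t.2 + 1 - t.1 - minPeriod (factor w t.1 t.2)) with hg
  -- The end is recovered from j + 1 = i + p + l; the subtractions do not truncate because the arm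
  -- is nonempty.
  have hinj : Set.InjOn g (maxDeltaSubrepetitions δ w) := by
    rintro ⟨i, j⟩ h ⟨i', j'⟩ h' e
    have h1 := isMaxRepeat_of_mem hδ h
    have h1' := isMaxRepeat_of_mem hδ h'
    have := h1.2.arm_pos
    have := h1'.2.arm_pos
    simp only [hg, Prod.mk.injEq] at e ⊢
    omega
  rw [← Finset.card_image_of_injOn hinj]
  refine card_maxRepeats_le (f := letter w) hn.ne' _ fun t ht => ?_
  obtain ⟨⟨i, j⟩, h, rfl⟩ := Finset.mem_image.1 ht
  exact (isMaxRepeat_of_mem hδ h).2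

end Subrep

theorem mainTheorem2 :
    ∃ C : ℝ, 0 < C ∧
      ∀ (A : Type*) (n : ℕ) (w : List A) (δ : ℝ), w.length = n → 0 < δ → δ < 1 →
        ((Subrep.maxDeltaSubrepetitions δ w).card : ℝ) ≤ C * ((n : ℝ) / δ) := by
  -- 576 = 2 · 288: since 1/δ > 1, rounding up at most doubles it.
  refine ⟨576, by norm_num, ?_⟩
  rintro A n w δ rfl h0 h1
  have h := Subrep.card_maxDeltaSubrepetitions_le w h0
  have hc : (⌈1 / δ⌉₊ : ℝ) ≤ 2 * (1 / δ) := by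
    have := Nat.ceil_lt_add_one (a := 1 / δ) (by positivity)
    have := one_lt_one_div h0 h1
    linarith
  calc ((Subrep.maxDeltaSubrepetitions δ w).card : ℝ)
      ≤ 288 * (w.length : ℝ) * (⌈1 / δ⌉₊ : ℝ) := by exact_mod_cast h
    _ ≤ 288 * (w.length : ℝ) * (2 * (1 / δ)) := by gcongr
    _ = 576 * ((w.length : ℝ) / δ) := by ring
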